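/- Let $p_1,p_2$ be natural numbers, $p_3=\min(p_1,p_2)$, $p_4=\max(p_1,p_2)$, and let $f:\mathbb R\to\mathbb R$ be twice continuously differentiable (for example smooth). For $B\in\mathbb R^{p_1\times p_2}$ put $R(B)=\sum_{j=1}^{p_3} f(\sigma_j(B))$, where $\sigma_1(B),\dots,\sigma_{p_3}(B)\ge 0$ are the singular values of $B$ with multiplicity. Let $B=U\,\mathrm{diag}[\sigma]\,V^\top$ be a singular value decomposition, with $U\in\mathbb R^{p_1\times p_1}$ and $V\in\mathbb R^{p_2\times p_2}$ orthogonal, columns $u_s$ and $v_t$, and $\mathrm{diag}[\sigma]$ the $p_1\times p_2$ matrix with diagonal entries $\sigma_1,\dots,\sigma_{p_3}\ge 0$ (in any order) and zeros elsewhere. Assume that the $\sigma_j$ are pairwise distinct and nonzero. Then $R$, as a function of $\mathrm{vec}(B)\in\mathbb R^{p_1p_2}$, is twice continuously differentiable at (that is, in a neighbourhood of) $\mathrm{vec}(B)$, and its Hessian matrix is $$\nabla^2R(B)=Q\begin{bmatrix}A_1&0&0\\0&A_2&0\\0&0&A_3\end{bmatrix}Q^\top .$$ Here $Q\in\mathbb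 R^{p_1p_2\times p_1p_2}$ is orthogonal. Its columns are indexed by three groups of pairs: $(s,s)$ with $1\le s\le p_3$; $(s,t)$ with $1\le s\ne t\le p_3$; and $(s,t)$ with $1\le t\le p_3<s\le p_4$. The column with index $(s,t)$ is $\mathrm{vec}(u_sv_t^\top)$, except that in the third group, when $p_1<p_2$, it is $\mathrm{vec}(u_tv_s^\top)$. The blocks correspond to the three groups: 1. $A_1\in\mathbb R^{p_3\times p_3}$ is diagonal with $A_{1,(ss,ss)}=f''(\sigma_s)$. 2. $A_2\in\mathbb R^{p_3(p_3-1)\times p_3(p_3-1)}$ has, for $s\ne t$, $$A_{2,(st,st)}=\frac{\sigma_sf'(\sigma_s)-\sigma_tf'(\sigma_t)}{\sigma_s^2-\sigma_t^2},\qquad A_{2,(st,ts)}=-\frac{\sigma_sf'(\sigma_t)-\sigma_tf'(\sigma_s)}{\sigma_s^2-\sigma_t^2},$$ and all its other entries are zero. 3. $A_3\in\mathbb R^{(p_4-p_3)p_3\times(p_4-p_3)p_3}$ is diagonal with $A_{3,(st,st)}=f'(\sigma_t)/\sigma_t$. -/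

import Mathlib

open scoped Matrix

noncomputable section

namespace SpectralHessian

/-- The `j`-th largest singular value (counted from `0`, with multiplicity) of a real matrix,
`j < min p₁ p₂`. -/
def singularValue {p₁ p₂ : ℕ} (B : Matrix (Fin p₁) (Fin p₂) ℝ) (j : Fin (min p₁ p₂)) : ℝ :=
  (Matrix.toEuclideanLin B).singularValues j

/-- The spectral function `R(B) = ∑_{j ≤ min(p₁, p₂)} f(σ_j(B))`. -/
def spectralFun {p₁ p₂ : ℕ} (f : ℝ → ℝ) (B : Matrix (Fin p₁) (Fin p₂) ℝ) : ℝ :=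
  ∑ j : Fin (min p₁ p₂), f (singularValue B j)

/-- The rectangular `p₁ × p₂` matrix with diagonal `σ` and all other entries zero. -/
def rectDiag {p₁ p₂ : ℕ} (σ : Fin (min p₁ p₂) → ℝ) : Matrix (Fin p₁) (Fin p₂) ℝ :=
  Matrix.of fun i j =>
    if h : (i : ℕ) = (j : ℕ) then σ ⟨i, lt_min i.isLt (h ▸ j.isLt)⟩ else 0

/-- `B = U diag[σ] Vᵀ` is a (full) singular value decomposition of `B`; no order is imposed on
the singular values. -/
structure IsSVD {p₁ p₂ : ℕ} (B : Matrix (Fin p₁) (Fin p₂) ℝ) (U : Matrix (Fin p₁) (Fin p₁) ℝ)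
    (σ : Fin (min p₁ p₂) → ℝ) (V : Matrix (Fin p₂) (Fin p₂) ℝ) : Prop where
  left_orthogonal : U ∈ Matrix.orthogonalGroup (Fin p₁) ℝ
  right_orthogonal : V ∈ Matrix.orthogonalGroup (Fin p₂) ℝ
  nonneg : ∀ j, 0 ≤ σ j
  eq_mul : B = U * rectDiag σ * Vᵀ

/-- `vec(B)` as a vector of the Euclidean space `ℝ^{p₁ p₂}` (columns of `B` stacked). -/
def vecE {p₁ p₂ : ℕ} (B : Matrix (Fin p₁) (Fin p₂) ℝ) : EuclideanSpace ℝ (Fin p₂ × Fin p₁) :=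
  WithLp.toLp 2 B.vec

/-- The inverse of vectorization. -/
def unvecE {p₁ p₂ : ℕ} (x : EuclideanSpace ℝ (Fin p₂ × Fin p₁)) : Matrix (Fin p₁) (Fin p₂) ℝ :=
  Matrix.of fun i j => x (j, i)

theorem unvecE_vecE {p₁ p₂ : ℕ} (B : Matrix (Fin p₁) (Fin p₂) ℝ) : unvecE (vecE B) = B := rfl

/-- A function of a matrix, read as a function of the vectorized matrix. -/
def onVec {p₁ p₂ : ℕ} (R : Matrix (Fin p₁) (Fin p₂) ℝ → ℝ) :
    EuclideanSpace ℝ (Fin p₂ × Fin p₁) → ℝ :=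
  fun x => R (unvecE x)

/-- The Hessian matrix `(∂² g / ∂x_a ∂x_b)(x)` in the canonical basis. -/
def hessianMatrix {ι : Type*} [Fintype ι] [DecidableEq ι] (g : EuclideanSpace ℝ ι → ℝ)
    (x : EuclideanSpace ℝ ι) : Matrix ι ι ℝ :=
  Matrix.of fun a b =>
    fderiv ℝ (fderiv ℝ g) x (EuclideanSpace.single a 1) (EuclideanSpace.single b 1)

/-- Index set of the second block: ordered pairs `(s, t)` with `s ≠ t`. -/
abbrev OffDiag (n : ℕ) : Type := {st : Fin n × Fin n // st.1 ≠ st.2}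

/-- Index set of the columns of `Q`. With `p₃ = min p₁ p₂` and `p₄ = max p₁ p₂`, the three parts
are the pairs `(s, s)`, the pairs `(s, t)` with `s ≠ t`, both at most `p₃`, and the pairs `(s, t)`
with `t ≤ p₃ < s ≤ p₄`, where `s` is written as `p₃` plus an index below `p₄ - p₃`. -/
abbrev BlockIndex (p₁ p₂ : ℕ) : Type :=
  Fin (min p₁ p₂) ⊕ (OffDiag (min p₁ p₂) ⊕ (Fin (max p₁ p₂ - min p₁ p₂) × Fin (min p₁ p₂)))

/-- The row and column of `Uᵀ B V` to which a block index belongs. In the third part the index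
`s > p₃` is a row if `p₂ ≤ p₁` and a column if `p₁ < p₂`. -/
def position {p₁ p₂ : ℕ} : BlockIndex p₁ p₂ → Fin p₁ × Fin p₂
  | .inl s => (s.castLE (min_le_left _ _), s.castLE (min_le_right _ _))
  | .inr (.inl st) => (st.1.1.castLE (min_le_left _ _), st.1.2.castLE (min_le_right _ _))
  | .inr (.inr (s, t)) =>
      if h : p₂ ≤ p₁ then
        (⟨min p₁ p₂ + s, by omega⟩, t.castLE (min_le_right _ _))
      else
        (t.castLE (min_le_left _ _), ⟨min p₁ p₂ + s, by omega⟩)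

/-- The matrix `Q` with columns `vec(u_s v_tᵀ)`. -/
def basisMatrix {p₁ p₂ : ℕ} (U : Matrix (Fin p₁) (Fin p₁) ℝ) (V : Matrix (Fin p₂) (Fin p₂) ℝ) :
    Matrix (Fin p₂ × Fin p₁) (BlockIndex p₁ p₂) ℝ :=
  Matrix.of fun a k =>
    (Matrix.vecMulVec (U.col (position k).1) (V.col (position k).2)).vec a

/-- First block: diagonal, with entries `f''(σ_s)`. -/
def blockOne {n : ℕ} (f : ℝ → ℝ) (σ : Fin n → ℝ) : Matrix (Fin n) (Fin n) ℝ :=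
  Matrix.diagonal fun s => deriv (deriv f) (σ s)

/-- Second block: it couples `(s, t)` with itself and with `(t, s)` only. -/
def blockTwo {n : ℕ} (f : ℝ → ℝ) (σ : Fin n → ℝ) : Matrix (OffDiag n) (OffDiag n) ℝ :=
  Matrix.of fun st kl =>
    let s := st.1.1
    let t := st.1.2
    if kl.1 = (s, t) then
      (σ s * deriv f (σ s) - σ t * deriv f (σ t)) / (σ s ^ 2 - σ t ^ 2)
    else if kl.1 = (t, s) then
      -((σ s * deriv f (σ t) - σ t * deriv f (σ s)) / (σ s ^ 2 - σ t ^ 2))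
    else 0

/-- Third block: diagonal, with entry `f'(σ_t) / σ_t` at `(s, t)`. -/
def blockThree {n : ℕ} (m : ℕ) (f : ℝ → ℝ) (σ : Fin n → ℝ) :
    Matrix (Fin m × Fin n) (Fin m × Fin n) ℝ :=
  Matrix.diagonal fun st => deriv f (σ st.2) / σ st.2

/-- The block diagonal matrix with blocks `A₁`, `A₂`, `A₃`. -/
def blockMatrix {p₁ p₂ : ℕ} (f : ℝ → ℝ) (σ : Fin (min p₁ p₂) → ℝ) :
    Matrix (BlockIndex p₁ p₂) (BlockIndex p₁ p₂) ℝ :=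
  Matrix.fromBlocks (blockOne f σ) 0 0
    (Matrix.fromBlocks (blockTwo f σ) 0 0 (blockThree (max p₁ p₂ - min p₁ p₂) f σ))

end SpectralHessian

end

/-!
Why the Hessian formula holds. At a matrix `B` with distinct nonzero singular values every singular
triple `(u_j, v_j, σ_j)` continues to a `C²` family of singular triples of the neighbouring
matrices. Indeed such triples are the zeros of `(M v - s u, Mᵀ u - s v, ‖u‖² + ‖v‖² - 2)`, and in
the coordinates of the singular value decomposition of `B` the linearization of these equations
splits into `2 × 2` systems with determinant `±(σ_k² - σ_j²)` and scalar equations with coefficient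
`σ_j` (`LinearizedTriple`), so the implicit function theorem applies
(`IsSVD.exists_contDiffAt_triple`). The continued values `s_j` stay positive and distinct, hence
they are all the `min(p₁, p₂)` singular values, and `R = ∑ f ∘ s_j` near `B`.

The derivative of `s_j` in direction `H` is `u_jᵀ H v_j` on a whole neighbourhood of `B`
(`fderiv_singularValue`), so the gradient of `R` is `H ↦ ∑ f'(s_j) u_jᵀ H v_j`. One more
differentiation, at `B` only, expresses the second derivative through the first-order perturbations
of `u_j` and `v_j` (`IsSVD.fderiv_fderiv_spectralFun`), which the linearized equations determine
explicitly. Collecting the coefficients of the entries of `Uᵀ H V` gives the three blocks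
(`sum_linearizedTriple_eq_sum_blockMatrix`). The matrix `Q` is the Kronecker product of `V` and `U`
with its columns relabelled by `position`, a bijection, and is therefore orthogonal.
-/

open scoped Matrix
open Topology Filter

namespace SpectralHessian

variable {p₁ p₂ : ℕ}

/-! ### Singular values and their linearized equations -/

/-- The `j`-th diagonal position, as a row index. -/
abbrev diagRow (j : Fin (min p₁ p₂)) : Fin p₁ := j.castLE (min_le_left _ _)

/-- The `j`-th diagonal position, as a column index. -/
abbrev diagCol (j : Fin (min p₁ p₂)) : Fin p₂ := j.castLE (min_le_right _ _)

/-- A positive `s` with a singular pair `(u, v)` is one of the first `min p₁ p₂` singular values: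
`s²` is an eigenvalue of `Mᵀ M`, and positive singular values have index below the rank. -/
theorem exists_singularValue_eq {M : Matrix (Fin p₁) (Fin p₂) ℝ} {u : Fin p₁ → ℝ}
    {v : Fin p₂ → ℝ} {s : ℝ} (hs : 0 < s) (hv : v ≠ 0) (h₁ : M *ᵥ v = s • u)
    (h₂ : Mᵀ *ᵥ u = s • v) : ∃ j : Fin (min p₁ p₂), singularValue M j = s := by
  set T := Matrix.toEuclideanLin M with hT
  have hn : Module.finrank ℝ (EuclideanSpace ℝ (Fin p₂)) = p₂ := by simp
  have hadj : LinearMap.adjoint T = Matrix.toEuclideanLin Mᵀ := by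
    rw [hT, ← Matrix.toEuclideanLin_conjTranspose_eq_adjoint,
      Matrix.conjTranspose_eq_transpose_of_trivial]
  have heig : Module.End.HasEigenvalue (LinearMap.adjoint T ∘ₗ T) (s ^ 2) := by
    refine Module.End.hasEigenvalue_of_hasEigenvector (x := WithLp.toLp 2 v) ⟨?_, ?_⟩
    · rw [Module.End.mem_eigenspace_iff, LinearMap.comp_apply, hadj, hT,
        Matrix.toLpLin_toLp, Matrix.toLpLin_toLp, Matrix.toLin'_apply, Matrix.toLin'_apply, h₁,
        Matrix.mulVec_smul, h₂, smul_smul, ← WithLp.toLp_smul, sq]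
    · intro h
      exact hv (by simpa using h)
  obtain ⟨i, hi⟩ := T.isSymmetric_adjoint_comp_self.exists_eigenvalues_eq hn heig
  have hval : T.singularValues i = s := by
    rw [T.singularValues_fin hn i]
    have : T.isSymmetric_adjoint_comp_self.eigenvalues hn i = s ^ 2 := by exact_mod_cast hi
    rw [this, Real.sqrt_sq hs.le]
  have hlt : (i : ℕ) < min p₁ p₂ := by
    refine lt_min ?_ i.isLt
    have h := T.singularValues_pos_iff_lt_finrank_range.1 (hval ▸ hs)
    refine h.trans_le ((Submodule.finrank_le _).trans ?_)
    simp
  exact ⟨⟨i, hlt⟩, hval⟩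

/-- If `min p₁ p₂` distinct positive numbers are singular values, they are all of them, so the
spectral function can be computed from them without sorting. -/
theorem spectralFun_eq_sum (f : ℝ → ℝ) {M : Matrix (Fin p₁) (Fin p₂) ℝ}
    {u : Fin (min p₁ p₂) → Fin p₁ → ℝ} {v : Fin (min p₁ p₂) → Fin p₂ → ℝ}
    {s : Fin (min p₁ p₂) → ℝ} (hs : ∀ j, 0 < s j) (hinj : Function.Injective s)
    (hv : ∀ j, v j ≠ 0) (h₁ : ∀ j, M *ᵥ v j = s j • u j) (h₂ : ∀ j, Mᵀ *ᵥ u j = s j • v j) :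
    spectralFun f M = ∑ j, f (s j) := by
  choose e he using fun j => exists_singularValue_eq (hs j) (hv j) (h₁ j) (h₂ j)
  have hbij : Function.Bijective e := Finite.injective_iff_bijective.1 fun a b hab =>
    hinj (by rw [← he a, ← he b, hab])
  rw [spectralFun, ← hbij.sum_comp]
  simp [he]

theorem rectDiag_mulVec_diagRow (σ : Fin (min p₁ p₂) → ℝ) (b : Fin p₂ → ℝ)
    (k : Fin (min p₁ p₂)) : (rectDiag σ *ᵥ b) (diagRow k) = σ k * b (diagCol k) := by
  rw [Matrix.mulVec, dotProduct, Finset.sum_eq_single (diagCol k)]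
  · simp [rectDiag]
  · intro j _ hj
    have : (k : ℕ) ≠ j := fun h => hj (Fin.ext h.symm)
    simp [rectDiag, this]
  · simp

theorem rectDiag_transpose_mulVec_diagCol (σ : Fin (min p₁ p₂) → ℝ) (a : Fin p₁ → ℝ)
    (k : Fin (min p₁ p₂)) : ((rectDiag σ)ᵀ *ᵥ a) (diagCol k) = σ k * a (diagRow k) := by
  rw [Matrix.mulVec, dotProduct, Finset.sum_eq_single (diagRow k)]
  · simp [rectDiag]
  · intro j _ hj
    have : (j : ℕ) ≠ k := fun h => hj (Fin.ext h)
    simp [rectDiag, this]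
  · simp

theorem rectDiag_mulVec_of_le (σ : Fin (min p₁ p₂) → ℝ) (b : Fin p₂ → ℝ) (i : Fin p₁)
    (hi : min p₁ p₂ ≤ i) : (rectDiag σ *ᵥ b) i = 0 := by
  rw [Matrix.mulVec, dotProduct]
  refine Finset.sum_eq_zero fun j _ => ?_
  have : (i : ℕ) ≠ j := by omega
  simp [rectDiag, this]

theorem rectDiag_transpose_mulVec_of_le (σ : Fin (min p₁ p₂) → ℝ) (a : Fin p₁ → ℝ) (i : Fin p₂)
    (hi : min p₁ p₂ ≤ i) : ((rectDiag σ)ᵀ *ᵥ a) i = 0 := by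
  rw [Matrix.mulVec, dotProduct]
  refine Finset.sum_eq_zero fun j _ => ?_
  have : (j : ℕ) ≠ i := by omega
  simp [rectDiag, this]

/-- The linearization at the `j`-th singular triple of `rectDiag σ` of the equations
`M v = s u`, `Mᵀ u = s v`, `‖u‖² + ‖v‖² = 2`: the perturbation `m` of the matrix moves the
triple by `(a, b, c)`. -/
structure LinearizedTriple (σ : Fin (min p₁ p₂) → ℝ) (j : Fin (min p₁ p₂))
    (m : Matrix (Fin p₁) (Fin p₂) ℝ) (a : Fin p₁ → ℝ) (b : Fin p₂ → ℝ) (c : ℝ) : Prop where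
  left : m *ᵥ Pi.single (diagCol j) 1 + rectDiag σ *ᵥ b =
    c • Pi.single (diagRow j) 1 + σ j • a
  right : mᵀ *ᵥ Pi.single (diagRow j) 1 + (rectDiag σ)ᵀ *ᵥ a =
    c • Pi.single (diagCol j) 1 + σ j • b
  norm : a (diagRow j) + b (diagCol j) = 0

namespace LinearizedTriple

variable {σ : Fin (min p₁ p₂) → ℝ} {j : Fin (min p₁ p₂)} {m : Matrix (Fin p₁) (Fin p₂) ℝ}
  {a : Fin p₁ → ℝ} {b : Fin p₂ → ℝ} {c : ℝ}

theorem left_apply (h : LinearizedTriple σ j m a b c) (k : Fin (min p₁ p₂)) :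
    m (diagRow k) (diagCol j) + σ k * b (diagCol k) =
      c * (if k = j then 1 else 0) + σ j * a (diagRow k) := by
  have := congrFun h.left (diagRow k)
  rw [Pi.add_apply, rectDiag_mulVec_diagRow] at this
  simpa [Pi.single_apply] using this

theorem right_apply (h : LinearizedTriple σ j m a b c) (k : Fin (min p₁ p₂)) :
    m (diagRow j) (diagCol k) + σ k * a (diagRow k) =
      c * (if k = j then 1 else 0) + σ j * b (diagCol k) := by
  have := congrFun h.right (diagCol k)
  rw [Pi.add_apply, rectDiag_transpose_mulVec_diagCol] at this
  simpa [Pi.single_apply] using this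

theorem value_eq (h : LinearizedTriple σ j m a b c) : c = m (diagRow j) (diagCol j) := by
  have h₁ := h.left_apply j
  have h₂ := h.right_apply j
  simp only [if_true] at h₁ h₂
  linarith

theorem left_self (h : LinearizedTriple σ j m a b c) (hσ : σ j ≠ 0) : a (diagRow j) = 0 := by
  have h₁ := h.left_apply j
  simp only [if_true] at h₁
  have h₃ := h.norm
  have h₄ : σ j * (2 * a (diagRow j)) = 0 := by
    linear_combination h₁ * (-1) + σ j * h₃ - h.value_eq
  simpa [hσ] using h₄

theorem right_self (h : LinearizedTriple σ j m a b c) (hσ : σ j ≠ 0) : b (diagCol j) = 0 := by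
  linarith [h.norm, h.left_self hσ]

/-- The left and right equations at `k ≠ j` form a `2 × 2` system for `a_k` and `b_k`; this is its
solution by Cramer's rule. -/
theorem left_off (h : LinearizedTriple σ j m a b c) {k : Fin (min p₁ p₂)} (hk : k ≠ j)
    (hσ : σ k ^ 2 - σ j ^ 2 ≠ 0) : a (diagRow k) =
      -(σ j * m (diagRow k) (diagCol j) + σ k * m (diagRow j) (diagCol k)) /
        (σ k ^ 2 - σ j ^ 2) := by
  have h₁ := h.left_apply k
  have h₂ := h.right_apply k
  simp only [hk, if_false] at h₁ h₂
  rw [eq_div_iff hσ]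
  linear_combination σ j * h₁ + σ k * h₂

theorem right_off (h : LinearizedTriple σ j m a b c) {k : Fin (min p₁ p₂)} (hk : k ≠ j)
    (hσ : σ k ^ 2 - σ j ^ 2 ≠ 0) : b (diagCol k) =
      -(σ j * m (diagRow j) (diagCol k) + σ k * m (diagRow k) (diagCol j)) /
        (σ k ^ 2 - σ j ^ 2) := by
  have h₁ := h.left_apply k
  have h₂ := h.right_apply k
  simp only [hk, if_false] at h₁ h₂
  rw [eq_div_iff hσ]
  linear_combination σ k * h₁ + σ j * h₂

/-- Rows beyond the diagonal square: `rectDiag σ` vanishes there, so the equation decouples. -/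
theorem left_of_le (h : LinearizedTriple σ j m a b c) (hσ : σ j ≠ 0) {i : Fin p₁}
    (hi : min p₁ p₂ ≤ i) : a i = m i (diagCol j) / σ j := by
  have := congrFun h.left i
  rw [Pi.add_apply, rectDiag_mulVec_of_le σ b i hi] at this
  have hne : i ≠ diagRow j := fun h => by
    have := congrArg Fin.val h
    simp at this
    omega
  simp [hne] at this
  rw [eq_div_iff hσ, this, mul_comm]

theorem right_of_le (h : LinearizedTriple σ j m a b c) (hσ : σ j ≠ 0) {i : Fin p₂}
    (hi : min p₁ p₂ ≤ i) : b i = m (diagRow j) i / σ j := by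
  have := congrFun h.right i
  rw [Pi.add_apply, rectDiag_transpose_mulVec_of_le σ a i hi] at this
  have hne : i ≠ diagCol j := fun h => by
    have := congrArg Fin.val h
    simp at this
    omega
  simp [hne] at this
  rw [eq_div_iff hσ, this, mul_comm]

/-- The linearization has trivial kernel: this is where distinctness and nonvanishing of the
singular values enter. -/
theorem eq_zero (h : LinearizedTriple σ j 0 a b c) (hσ : σ j ≠ 0)
    (hd : ∀ k, k ≠ j → σ k ^ 2 - σ j ^ 2 ≠ 0) : a = 0 ∧ b = 0 ∧ c = 0 := by
  refine ⟨funext fun i => ?_, funext fun i => ?_, by simpa using h.value_eq⟩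
  · rcases lt_or_ge (i : ℕ) (min p₁ p₂) with hi | hi
    · obtain ⟨k, rfl⟩ : ∃ k : Fin (min p₁ p₂), diagRow k = i := ⟨⟨i, hi⟩, rfl⟩
      by_cases hk : k = j
      · subst hk; exact h.left_self hσ
      · simp [h.left_off hk (hd k hk)]
    · simp [h.left_of_le hσ hi]
  · rcases lt_or_ge (i : ℕ) (min p₁ p₂) with hi | hi
    · obtain ⟨k, rfl⟩ : ∃ k : Fin (min p₁ p₂), diagCol k = i := ⟨⟨i, hi⟩, rfl⟩
      by_cases hk : k = j
      · subst hk; exact h.right_self hσ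
      · simp [h.right_off hk (hd k hk)]
    · simp [h.right_of_le hσ hi]

end LinearizedTriple

/-- A perturbation `(du, dv, ds)` of the `j`-th singular triple of `B` caused by `H` satisfies, in
the coordinates of a singular value decomposition of `B`, the diagonal linearized equations. -/
theorem IsSVD.linearizedTriple {B U σ V} (hB : IsSVD (p₁ := p₁) (p₂ := p₂) B U σ V)
    {j : Fin (min p₁ p₂)} {H : Matrix (Fin p₁) (Fin p₂) ℝ} {du : Fin p₁ → ℝ} {dv : Fin p₂ → ℝ}
    {ds : ℝ}
    (h₁ : H *ᵥ V.col (diagCol j) + B *ᵥ dv = ds • U.col (diagRow j) + σ j • du)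
    (h₂ : Hᵀ *ᵥ U.col (diagRow j) + Bᵀ *ᵥ du = ds • V.col (diagCol j) + σ j • dv)
    (h₃ : U.col (diagRow j) ⬝ᵥ du + V.col (diagCol j) ⬝ᵥ dv = 0) :
    LinearizedTriple σ j (Uᵀ * H * V) (Uᵀ *ᵥ du) (Vᵀ *ᵥ dv) ds := by
  have hU : Uᵀ * U = 1 := (Matrix.mem_orthogonalGroup_iff' _ _).1 hB.left_orthogonal
  have hV : Vᵀ * V = 1 := (Matrix.mem_orthogonalGroup_iff' _ _).1 hB.right_orthogonal
  refine ⟨?_, ?_, ?_⟩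
  · have := congrArg (Uᵀ *ᵥ ·) h₁
    simp only [hB.eq_mul, ← Matrix.mulVec_single_one, Matrix.mulVec_add, Matrix.mulVec_smul,
      Matrix.mulVec_mulVec] at this
    simpa only [← Matrix.mul_assoc, hU, Matrix.one_mul, Matrix.one_mulVec,
      ← Matrix.mulVec_mulVec (M := Uᵀ * _ * _), ← Matrix.mulVec_mulVec (M := rectDiag σ)] using this
  · have := congrArg (Vᵀ *ᵥ ·) h₂
    simp only [hB.eq_mul, ← Matrix.mulVec_single_one, Matrix.mulVec_add, Matrix.mulVec_smul,
      Matrix.mulVec_mulVec, Matrix.transpose_mul, Matrix.transpose_transpose] at this ⊢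
    simpa only [← Matrix.mul_assoc, hV, Matrix.one_mul, Matrix.one_mulVec] using this
  · exact h₃

theorem IsSVD.mulVec_col {B U σ V} (hB : IsSVD (p₁ := p₁) (p₂ := p₂) B U σ V)
    (j : Fin (min p₁ p₂)) : B *ᵥ V.col (diagCol j) = σ j • U.col (diagRow j) := by
  have hV : Vᵀ * V = 1 := (Matrix.mem_orthogonalGroup_iff' _ _).1 hB.right_orthogonal
  have : rectDiag σ *ᵥ Pi.single (diagCol j) 1 = σ j • Pi.single (diagRow j) (1 : ℝ) := by
    ext i
    simp [rectDiag, Pi.single_apply, Fin.ext_iff]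
    grind
  rw [hB.eq_mul, ← Matrix.mulVec_single_one, Matrix.mulVec_mulVec, Matrix.mul_assoc, hV,
    Matrix.mul_one, ← Matrix.mulVec_mulVec, this, Matrix.mulVec_smul, Matrix.mulVec_single_one]

theorem IsSVD.transpose_mulVec_col {B U σ V} (hB : IsSVD (p₁ := p₁) (p₂ := p₂) B U σ V)
    (j : Fin (min p₁ p₂)) : Bᵀ *ᵥ U.col (diagRow j) = σ j • V.col (diagCol j) := by
  have hU : Uᵀ * U = 1 := (Matrix.mem_orthogonalGroup_iff' _ _).1 hB.left_orthogonal
  have : (rectDiag σ)ᵀ *ᵥ Pi.single (diagRow j) 1 = σ j • Pi.single (diagCol j) (1 : ℝ) := by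
    ext i
    simp [rectDiag, Pi.single_apply, Fin.ext_iff]
    grind
  rw [hB.eq_mul, ← Matrix.mulVec_single_one, Matrix.mulVec_mulVec, Matrix.transpose_mul,
    Matrix.transpose_mul, Matrix.transpose_transpose, Matrix.mul_assoc, Matrix.mul_assoc, hU,
    Matrix.mul_one, ← Matrix.mulVec_mulVec, this, Matrix.mulVec_smul, Matrix.mulVec_single_one]

theorem col_dotProduct_col_self {n : ℕ} {U : Matrix (Fin n) (Fin n) ℝ}
    (hU : U ∈ Matrix.orthogonalGroup (Fin n) ℝ) (i : Fin n) : U.col i ⬝ᵥ U.col i = 1 := by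
  have h := congrFun (congrFun ((Matrix.mem_orthogonalGroup_iff' _ _).1 hU) i) i
  rwa [Matrix.one_apply_eq] at h

/-! ### Smooth continuation of singular triples -/

theorem hasDerivAt_unvecE_mulVec {x : ℝ → EuclideanSpace ℝ (Fin p₂ × Fin p₁)} {x'}
    {v : ℝ → Fin p₂ → ℝ} {v'} {t : ℝ} (hx : HasDerivAt x x' t) (hv : HasDerivAt v v' t) :
    HasDerivAt (fun τ => unvecE (x τ) *ᵥ v τ) (unvecE x' *ᵥ v t + unvecE (x t) *ᵥ v') t := by
  rw [hasDerivAt_pi] at hv ⊢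
  have hx' : ∀ a, HasDerivAt (fun τ => x τ a) (x' a) t := fun a =>
    (EuclideanSpace.proj (𝕜 := ℝ) a).hasFDerivAt.comp_hasDerivAt t hx
  intro i
  have := HasDerivAt.fun_sum (u := Finset.univ) fun j _ => (hx' (j, i)).mul (hv j)
  rw [Finset.sum_add_distrib] at this
  exact this

theorem hasDerivAt_unvecE_transpose_mulVec {x : ℝ → EuclideanSpace ℝ (Fin p₂ × Fin p₁)} {x'}
    {u : ℝ → Fin p₁ → ℝ} {u'} {t : ℝ} (hx : HasDerivAt x x' t) (hu : HasDerivAt u u' t) :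
    HasDerivAt (fun τ => (unvecE (x τ))ᵀ *ᵥ u τ)
      ((unvecE x')ᵀ *ᵥ u t + (unvecE (x t))ᵀ *ᵥ u') t := by
  rw [hasDerivAt_pi] at hu ⊢
  have hx' : ∀ a, HasDerivAt (fun τ => x τ a) (x' a) t := fun a =>
    (EuclideanSpace.proj (𝕜 := ℝ) a).hasFDerivAt.comp_hasDerivAt t hx
  intro i
  have := HasDerivAt.fun_sum (u := Finset.univ) fun j _ => (hx' (i, j)).mul (hu j)
  rw [Finset.sum_add_distrib] at this
  exact this

theorem hasDerivAt_dotProduct {n : ℕ} {u v : ℝ → Fin n → ℝ} {u' v' : Fin n → ℝ} {t : ℝ}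
    (hu : HasDerivAt u u' t) (hv : HasDerivAt v v' t) :
    HasDerivAt (fun τ => u τ ⬝ᵥ v τ) (u' ⬝ᵥ v t + u t ⬝ᵥ v') t := by
  rw [hasDerivAt_pi] at hu hv
  have := HasDerivAt.fun_sum (u := Finset.univ) fun j _ => (hu j).mul (hv j)
  rw [Finset.sum_add_distrib] at this
  exact this

/-- The map whose zeros `(M, (u, v, s))` are the singular triples of `M`, that is `M v = s u` and
`Mᵀ u = s v`, normalized by `‖u‖² + ‖v‖² = 2`. -/
def tripleMap (z : EuclideanSpace ℝ (Fin p₂ × Fin p₁) × (Fin p₁ → ℝ) × (Fin p₂ → ℝ) × ℝ) :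
    (Fin p₁ → ℝ) × (Fin p₂ → ℝ) × ℝ :=
  (unvecE z.1 *ᵥ z.2.2.1 - z.2.2.2 • z.2.1, (unvecE z.1)ᵀ *ᵥ z.2.1 - z.2.2.2 • z.2.2.1,
    z.2.1 ⬝ᵥ z.2.1 + z.2.2.1 ⬝ᵥ z.2.2.1 - 2)

theorem contDiff_tripleMap : ContDiff ℝ 2 (tripleMap (p₁ := p₁) (p₂ := p₂)) := by
  refine .prodMk ?_ (.prodMk ?_ ?_)
  · rw [contDiff_pi]
    intro i
    simp only [Pi.sub_apply, Matrix.mulVec, dotProduct, unvecE, Matrix.of_apply, Pi.smul_apply,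
      smul_eq_mul]
    fun_prop
  · rw [contDiff_pi]
    intro i
    simp only [Pi.sub_apply, Matrix.mulVec, dotProduct, unvecE, Matrix.of_apply, Pi.smul_apply,
      smul_eq_mul, Matrix.transpose_apply]
    fun_prop
  · simp only [dotProduct]
    fun_prop

theorem hasDerivAt_tripleMap {x : ℝ → EuclideanSpace ℝ (Fin p₂ × Fin p₁)} {x'}
    {u : ℝ → Fin p₁ → ℝ} {u'} {v : ℝ → Fin p₂ → ℝ} {v'} {s : ℝ → ℝ} {s'} {t : ℝ}
    (hx : HasDerivAt x x' t) (hu : HasDerivAt u u' t) (hv : HasDerivAt v v' t)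
    (hs : HasDerivAt s s' t) :
    HasDerivAt (fun τ => tripleMap (x τ, u τ, v τ, s τ))
      (unvecE x' *ᵥ v t + unvecE (x t) *ᵥ v' - (s t • u' + s' • u t),
        (unvecE x')ᵀ *ᵥ u t + (unvecE (x t))ᵀ *ᵥ u' - (s t • v' + s' • v t),
        2 * (u t ⬝ᵥ u' + v t ⬝ᵥ v')) t := by
  refine ((hasDerivAt_unvecE_mulVec hx hv).sub (hs.smul hu)).prodMk
    (((hasDerivAt_unvecE_transpose_mulVec hx hu).sub (hs.smul hv)).prodMk ?_)
  convert! ((hasDerivAt_dotProduct hu hu).add (hasDerivAt_dotProduct hv hv)).sub_const 2 using 1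
  rw [dotProduct_comm u', dotProduct_comm v']
  ring

/-- Differentiating the equations of a family of singular triples in direction `k`. -/
theorem linearized_of_tripleMap_eq_zero {u : EuclideanSpace ℝ (Fin p₂ × Fin p₁) → Fin p₁ → ℝ}
    {v : EuclideanSpace ℝ (Fin p₂ × Fin p₁) → Fin p₂ → ℝ}
    {s : EuclideanSpace ℝ (Fin p₂ × Fin p₁) → ℝ} {x : EuclideanSpace ℝ (Fin p₂ × Fin p₁)}
    (hu : DifferentiableAt ℝ u x) (hv : DifferentiableAt ℝ v x) (hs : DifferentiableAt ℝ s x)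
    (h : ∀ᶠ y in 𝓝 x, tripleMap (y, u y, v y, s y) = 0)
    (k : EuclideanSpace ℝ (Fin p₂ × Fin p₁)) :
    unvecE k *ᵥ v x + unvecE x *ᵥ fderiv ℝ v x k = fderiv ℝ s x k • u x + s x • fderiv ℝ u x k ∧
      (unvecE k)ᵀ *ᵥ u x + (unvecE x)ᵀ *ᵥ fderiv ℝ u x k =
        fderiv ℝ s x k • v x + s x • fderiv ℝ v x k ∧
      u x ⬝ᵥ fderiv ℝ u x k + v x ⬝ᵥ fderiv ℝ v x k = 0 := by
  have hline : HasDerivAt (fun t : ℝ => x + t • k) k 0 := by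
    simpa using ((hasDerivAt_id (0 : ℝ)).smul_const k).const_add x
  have h0 : x + (0 : ℝ) • k = x := by simp
  have hd := hasDerivAt_tripleMap hline (hu.hasFDerivAt.hasLineDerivAt k)
    (hv.hasFDerivAt.hasLineDerivAt k) (hs.hasFDerivAt.hasLineDerivAt k)
  have hc : Tendsto (fun t : ℝ => x + t • k) (𝓝 0) (𝓝 x) := by
    simpa [h0] using hline.continuousAt.tendsto
  have he := hd.unique ((hasDerivAt_const (0 : ℝ)
    (0 : (Fin p₁ → ℝ) × (Fin p₂ → ℝ) × ℝ)).congr_of_eventuallyEq (hc.eventually h))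
  simp only [h0, Prod.ext_iff, Prod.fst_zero, Prod.snd_zero, sub_eq_zero] at he
  refine ⟨he.1.trans (add_comm _ _), he.2.1.trans (add_comm _ _), by linarith [he.2.2]⟩

/-- The derivative of a singular value is `H ↦ uᵀ H v`. Pairing the two linearized equations with
`u` and `v` and adding them, all terms containing derivatives of `u` and `v` cancel. -/
theorem fderiv_singularValue {u : EuclideanSpace ℝ (Fin p₂ × Fin p₁) → Fin p₁ → ℝ}
    {v : EuclideanSpace ℝ (Fin p₂ × Fin p₁) → Fin p₂ → ℝ}
    {s : EuclideanSpace ℝ (Fin p₂ × Fin p₁) → ℝ} {x : EuclideanSpace ℝ (Fin p₂ × Fin p₁)}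
    (hu : DifferentiableAt ℝ u x) (hv : DifferentiableAt ℝ v x) (hs : DifferentiableAt ℝ s x)
    (h : ∀ᶠ y in 𝓝 x, tripleMap (y, u y, v y, s y) = 0)
    (k : EuclideanSpace ℝ (Fin p₂ × Fin p₁)) :
    fderiv ℝ s x k = u x ⬝ᵥ unvecE k *ᵥ v x := by
  obtain ⟨h₁, h₂, -⟩ := linearized_of_tripleMap_eq_zero hu hv hs h k
  have h₀ := h.self_of_nhds
  simp only [tripleMap, Prod.ext_iff, Prod.fst_zero, Prod.snd_zero, sub_eq_zero] at h₀
  obtain ⟨e₁, e₂, e₃⟩ := h₀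
  have q₁ := congrArg (u x ⬝ᵥ ·) h₁
  have q₂ := congrArg (v x ⬝ᵥ ·) h₂
  simp only [dotProduct_add, dotProduct_smul, smul_eq_mul, Matrix.dotProduct_mulVec,
    ← Matrix.mulVec_transpose, e₁, e₂, smul_dotProduct,
    Matrix.transpose_transpose] at q₁ q₂ ⊢
  have q₃ : unvecE k *ᵥ v x ⬝ᵥ u x = (unvecE k)ᵀ *ᵥ u x ⬝ᵥ v x := by
    rw [dotProduct_comm, Matrix.dotProduct_mulVec, ← Matrix.mulVec_transpose]
  have q₄ : fderiv ℝ s x k * (u x ⬝ᵥ u x + v x ⬝ᵥ v x) = fderiv ℝ s x k * 2 := by rw [e₃]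
  linarith

/-- By the implicit function theorem the `j`-th singular triple extends to a `C²` family of
singular triples of the neighbouring matrices. -/
theorem IsSVD.exists_contDiffAt_triple {B U σ V} (hB : IsSVD (p₁ := p₁) (p₂ := p₂) B U σ V)
    (j : Fin (min p₁ p₂)) (hσ : σ j ≠ 0) (hd : ∀ k, k ≠ j → σ k ^ 2 - σ j ^ 2 ≠ 0) :
    ∃ (u : EuclideanSpace ℝ (Fin p₂ × Fin p₁) → Fin p₁ → ℝ)
      (v : EuclideanSpace ℝ (Fin p₂ × Fin p₁) → Fin p₂ → ℝ)
      (s : EuclideanSpace ℝ (Fin p₂ × Fin p₁) → ℝ),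
      ContDiffAt ℝ 2 u (vecE B) ∧ ContDiffAt ℝ 2 v (vecE B) ∧ ContDiffAt ℝ 2 s (vecE B) ∧
      u (vecE B) = U.col (diagRow j) ∧ v (vecE B) = V.col (diagCol j) ∧ s (vecE B) = σ j ∧
      ∀ᶠ x in 𝓝 (vecE B), tripleMap (x, u x, v x, s x) = 0 := by
  set z₀ : (Fin p₁ → ℝ) × (Fin p₂ → ℝ) × ℝ := (U.col (diagRow j), V.col (diagCol j), σ j) with hz
  have hC : ContDiffAt ℝ 2 (tripleMap (p₁ := p₁) (p₂ := p₂)) (vecE B, z₀) :=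
    contDiff_tripleMap.contDiffAt
  have hzero : tripleMap (vecE B, z₀) = 0 := by
    simp only [tripleMap, hz, unvecE_vecE, hB.mulVec_col, hB.transpose_mulVec_col,
      col_dotProduct_col_self hB.left_orthogonal, col_dotProduct_col_self hB.right_orthogonal,
      sub_self, Prod.mk_eq_zero, true_and]
    norm_num
  have hU : U * Uᵀ = 1 := (Matrix.mem_orthogonalGroup_iff _ _).1 hB.left_orthogonal
  have hV : V * Vᵀ = 1 := (Matrix.mem_orthogonalGroup_iff _ _).1 hB.right_orthogonal
  have hinj : Function.Injective
      (fderiv ℝ (tripleMap (p₁ := p₁) (p₂ := p₂)) (vecE B, z₀) ∘L .inr ℝ _ _) := by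
    rw [injective_iff_map_eq_zero]
    rintro ⟨du, dv, ds⟩ h
    have hu : HasDerivAt (fun t : ℝ => U.col (diagRow j) + t • du) du 0 := by
      simpa using ((hasDerivAt_id (0 : ℝ)).smul_const du).const_add (U.col (diagRow j))
    have hv : HasDerivAt (fun t : ℝ => V.col (diagCol j) + t • dv) dv 0 := by
      simpa using ((hasDerivAt_id (0 : ℝ)).smul_const dv).const_add (V.col (diagCol j))
    have hs : HasDerivAt (fun t : ℝ => σ j + t • ds) ds 0 := by
      simpa using ((hasDerivAt_id (0 : ℝ)).smul_const ds).const_add (σ j)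
    have hcurve := (hasDerivAt_const (0 : ℝ) (vecE B)).prodMk (hu.prodMk (hv.prodMk hs))
    have hF := (hC.differentiableAt (by norm_num)).hasFDerivAt
    have hcomp := HasFDerivAt.comp_hasDerivAt (0 : ℝ)
      (f := fun t : ℝ => (vecE B, U.col (diagRow j) + t • du, V.col (diagCol j) + t • dv,
        σ j + t • ds)) (by simpa [hz] using hF) hcurve
    have he := (hasDerivAt_tripleMap (hasDerivAt_const (0 : ℝ) (vecE B)) hu hv hs).unique hcomp
    rw [show (fderiv ℝ tripleMap (vecE B, U.col (diagRow j), V.col (diagCol j), σ j))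
      (0, du, dv, ds) = 0 from h] at he
    have hz0 : unvecE (p₁ := p₁) (p₂ := p₂) 0 = 0 := rfl
    simp only [zero_smul, add_zero, Prod.ext_iff, Prod.fst_zero, Prod.snd_zero, sub_eq_zero,
      unvecE_vecE] at he
    have hlin := hB.linearizedTriple (H := 0) (j := j) (du := du) (dv := dv) (ds := ds)
      (by rw [add_comm (ds • _), ← he.1, hz0]) (by rw [add_comm (ds • _), ← he.2.1, hz0])
      (by linarith [he.2.2])
    simp only [Matrix.mul_zero, Matrix.zero_mul] at hlin
    obtain ⟨ha, hb, hc⟩ := hlin.eq_zero hσ hd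
    have ha' := congrArg (U *ᵥ ·) ha
    have hb' := congrArg (V *ᵥ ·) hb
    simp only [Matrix.mulVec_mulVec, hU, hV, Matrix.one_mulVec, Matrix.mulVec_zero] at ha' hb'
    simp [ha', hb', hc]
  -- source and target have the same finite dimension, so injectivity suffices
  have hinv : (fderiv ℝ (tripleMap (p₁ := p₁) (p₂ := p₂)) (vecE B, z₀) ∘L
      .inr ℝ _ _).IsInvertible :=
    ⟨(LinearEquiv.ofInjectiveEndo _ hinj).toContinuousLinearEquiv,
      ContinuousLinearMap.ext fun _ => rfl⟩
  have h2 : (2 : WithTop ℕ∞) ≠ 0 := by norm_num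
  have hψ := hC.contDiffAt_implicitFunction h2 hinv
  have hψ0 := hC.implicitFunction_apply_self h2 hinv
  have hψe := hC.eventually_apply_implicitFunction h2 hinv
  set ψ := hC.implicitFunction h2 hinv
  refine ⟨fun x => (ψ x).1, fun x => (ψ x).2.1, fun x => (ψ x).2.2, hψ.fst, hψ.snd.fst,
    hψ.snd.snd, ?_, ?_, ?_, ?_⟩
  · exact congrArg (·.1) hψ0
  · exact congrArg (·.2.1) hψ0
  · exact congrArg (·.2.2) hψ0
  · simpa only [hzero] using hψe

/-! ### The second derivative of the spectral function -/

/-- The normalization `‖u‖² + ‖v‖² = 2` excludes `v = 0`, so zeros of `tripleMap` are genuine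
singular triples. -/
theorem spectralFun_eq_sum_of_tripleMap_eq_zero (f : ℝ → ℝ)
    {x : EuclideanSpace ℝ (Fin p₂ × Fin p₁)} {u : Fin (min p₁ p₂) → Fin p₁ → ℝ}
    {v : Fin (min p₁ p₂) → Fin p₂ → ℝ} {s : Fin (min p₁ p₂) → ℝ} (hs : ∀ j, 0 < s j)
    (hinj : Function.Injective s) (h : ∀ j, tripleMap (x, u j, v j, s j) = 0) :
    onVec (spectralFun f) x = ∑ j, f (s j) := by
  simp only [tripleMap, Prod.ext_iff, Prod.fst_zero, Prod.snd_zero, sub_eq_zero] at h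
  refine spectralFun_eq_sum f hs hinj (fun j hv => ?_) (fun j => (h j).1) (fun j => (h j).2.1)
  obtain ⟨h₁, -, h₃⟩ := h j
  rw [hv, Matrix.mulVec_zero, eq_comm, smul_eq_zero, or_iff_right (hs j).ne'] at h₁
  simp [h₁, hv] at h₃

theorem transpose_mul_mul_col (U : Matrix (Fin p₁) (Fin p₁) ℝ) (K : Matrix (Fin p₁) (Fin p₂) ℝ)
    (V : Matrix (Fin p₂) (Fin p₂) ℝ) (j : Fin p₂) :
    (Uᵀ * K * V).col j = Uᵀ *ᵥ (K *ᵥ V.col j) := by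
  rw [← Matrix.mulVec_single_one, ← Matrix.mulVec_single_one, Matrix.mulVec_mulVec,
    Matrix.mulVec_mulVec, Matrix.mul_assoc]

theorem transpose_mul_mul_row (U : Matrix (Fin p₁) (Fin p₁) ℝ) (K : Matrix (Fin p₁) (Fin p₂) ℝ)
    (V : Matrix (Fin p₂) (Fin p₂) ℝ) (i : Fin p₁) :
    (Uᵀ * K * V).row i = (U.col i ᵥ* K) ᵥ* V := by
  rw [← Matrix.single_one_vecMul, ← Matrix.vecMul_vecMul, ← Matrix.vecMul_vecMul,
    Matrix.single_one_vecMul]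
  rfl

theorem transpose_mul_mul_apply (U : Matrix (Fin p₁) (Fin p₁) ℝ) (K : Matrix (Fin p₁) (Fin p₂) ℝ)
    (V : Matrix (Fin p₂) (Fin p₂) ℝ) (i : Fin p₁) (j : Fin p₂) :
    (Uᵀ * K * V) i j = U.col i ⬝ᵥ K *ᵥ V.col j :=
  congrFun (transpose_mul_mul_col U K V j) i

/-- Near a matrix with distinct nonzero singular values the spectral function is `C²`, and its
second derivative is expressed through the first-order perturbations of the singular triples in
the coordinates of the singular value decomposition. -/
theorem IsSVD.fderiv_fderiv_spectralFun {f : ℝ → ℝ} (hf : ContDiff ℝ 2 f) {B U σ V}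
    (hB : IsSVD (p₁ := p₁) (p₂ := p₂) B U σ V) (hpos : ∀ j, 0 < σ j)
    (hinj : Function.Injective σ) (hd : ∀ k j, k ≠ j → σ k ^ 2 - σ j ^ 2 ≠ 0) :
    ContDiffAt ℝ 2 (onVec (spectralFun f)) (vecE B) ∧
      ∀ h, ∃ (a : Fin (min p₁ p₂) → Fin p₁ → ℝ) (b : Fin (min p₁ p₂) → Fin p₂ → ℝ)
        (c : Fin (min p₁ p₂) → ℝ),
        (∀ j, LinearizedTriple σ j (Uᵀ * unvecE h * V) (a j) (b j) (c j)) ∧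
        ∀ k, fderiv ℝ (fderiv ℝ (onVec (spectralFun f))) (vecE B) h k =
          ∑ j, (deriv (deriv f) (σ j) * c j * (Uᵀ * unvecE k * V) (diagRow j) (diagCol j) +
            deriv f (σ j) * (a j ⬝ᵥ (Uᵀ * unvecE k * V).col (diagCol j) +
              (Uᵀ * unvecE k * V).row (diagRow j) ⬝ᵥ b j)) := by
  have hU : U * Uᵀ = 1 := (Matrix.mem_orthogonalGroup_iff _ _).1 hB.left_orthogonal
  have hV : V * Vᵀ = 1 := (Matrix.mem_orthogonalGroup_iff _ _).1 hB.right_orthogonal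
  have hl : ∀ x y : Fin p₁ → ℝ, Uᵀ *ᵥ x ⬝ᵥ Uᵀ *ᵥ y = x ⬝ᵥ y := fun x y => by
    rw [Matrix.dotProduct_mulVec, Matrix.vecMul_transpose, Matrix.mulVec_mulVec, hU,
      Matrix.one_mulVec]
  have hr : ∀ (x : Fin p₁ → ℝ) (K : Matrix (Fin p₁) (Fin p₂) ℝ) (y : Fin p₂ → ℝ),
      x ᵥ* K ᵥ* V ⬝ᵥ Vᵀ *ᵥ y = x ⬝ᵥ K *ᵥ y := fun x K y => by
    rw [← Matrix.dotProduct_mulVec, Matrix.mulVec_mulVec, hV, Matrix.one_mulVec,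
      ← Matrix.dotProduct_mulVec]
  choose u v s hu hv hs hu₀ hv₀ hs₀ hz using
    fun j => hB.exists_contDiffAt_triple j (hpos j).ne' fun k hk => hd k j hk
  have hz' : ∀ᶠ x in 𝓝 (vecE B), ∀ j, tripleMap (x, u j x, v j x, s j x) = 0 :=
    eventually_all.2 hz
  have hpos' : ∀ᶠ x in 𝓝 (vecE B), ∀ j, 0 < s j x := eventually_all.2 fun j =>
    (hs j).continuousAt.eventually_const_lt (by rw [hs₀]; exact hpos j)
  have hinj' : ∀ᶠ x in 𝓝 (vecE B), ∀ k j, k ≠ j → s k x ≠ s j x := by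
    refine eventually_all.2 fun k => eventually_all.2 fun j => ?_
    by_cases hkj : k = j
    · simp [hkj]
    · have := ((hs k).continuousAt.sub (hs j).continuousAt).eventually_ne
        (y := 0) (by simpa [hs₀, sub_eq_zero] using fun h => hkj (hinj h))
      filter_upwards [this] with x hx _ using sub_ne_zero.1 hx
  have hR : onVec (spectralFun f) =ᶠ[𝓝 (vecE B)] fun x => ∑ j, f (s j x) := by
    filter_upwards [hz', hpos', hinj'] with x h₁ h₂ h₃
    exact spectralFun_eq_sum_of_tripleMap_eq_zero f h₂
      (fun k j hkj => by_contra fun hne => h₃ k j hne hkj) h₁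
  have hC : ContDiffAt ℝ 2 (onVec (spectralFun f)) (vecE B) :=
    (ContDiffAt.sum fun j _ => hf.contDiffAt.comp _ (hs j)).congr_of_eventuallyEq hR
  refine ⟨hC, fun h => ?_⟩
  have hfd : Differentiable ℝ f := hf.differentiable (by norm_num)
  have hdiff : ∀ {G : Type} [NormedAddCommGroup G] [NormedSpace ℝ G]
      {g : EuclideanSpace ℝ (Fin p₂ × Fin p₁) → G} {x}, ContDiffAt ℝ 2 g x →
      DifferentiableAt ℝ g x := fun hg => hg.differentiableAt (by norm_num)
  have hev : ∀ {G : Type} [NormedAddCommGroup G] [NormedSpace ℝ G]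
      {g : EuclideanSpace ℝ (Fin p₂ × Fin p₁) → G}, ContDiffAt ℝ 2 g (vecE B) →
      ∀ᶠ x in 𝓝 (vecE B), DifferentiableAt ℝ g x := fun hg =>
    (hg.eventually (by simp)).mono fun x hx => hdiff hx
  have hgrad : ∀ k, (fun x => fderiv ℝ (onVec (spectralFun f)) x k) =ᶠ[𝓝 (vecE B)]
      fun x => ∑ j, deriv f (s j x) * (u j x ⬝ᵥ unvecE k *ᵥ v j x) := by
    intro k
    filter_upwards [hR.eventuallyEq_nhds, eventually_all.2 fun j => hev (hu j),
      eventually_all.2 fun j => hev (hv j), eventually_all.2 fun j => hev (hs j),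
      hz'.eventually_nhds] with x h₁ h₂ h₃ h₄ h₅
    have hsum := HasFDerivAt.fun_sum (u := Finset.univ) fun j _ =>
      (hfd (s j x)).hasDerivAt.comp_hasFDerivAt x (h₄ j).hasFDerivAt
    rw [h₁.fderiv_eq]
    refine (congrArg (· k) hsum.fderiv).trans ?_
    rw [sum_apply]
    refine Finset.sum_congr rfl fun j _ => ?_
    rw [smul_apply, smul_eq_mul,
      fderiv_singularValue (h₂ j) (h₃ j) (h₄ j) (h₅.mono fun y hy => hy j)]
  -- the perturbations are the derivatives of the triples, in the bases `U` and `V`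
  refine ⟨fun j => Uᵀ *ᵥ fderiv ℝ (u j) (vecE B) h, fun j => Vᵀ *ᵥ fderiv ℝ (v j) (vecE B) h,
    fun j => fderiv ℝ (s j) (vecE B) h, fun j => ?_, fun k => ?_⟩
  · have := linearized_of_tripleMap_eq_zero (hdiff (hu j)) (hdiff (hv j)) (hdiff (hs j)) (hz j) h
    rw [unvecE_vecE, hu₀, hv₀, hs₀] at this
    exact hB.linearizedTriple this.1 this.2.1 this.2.2
  · have hd2 : DifferentiableAt ℝ (fderiv ℝ (onVec (spectralFun f))) (vecE B) :=
      (hC.fderiv_right (m := 1) (by norm_num)).differentiableAt (by norm_num)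
    have h₁ : fderiv ℝ (fderiv ℝ (onVec (spectralFun f))) (vecE B) h k =
        fderiv ℝ (fun x => fderiv ℝ (onVec (spectralFun f)) x k) (vecE B) h := by
      rw [fderiv_clm_apply hd2 (differentiableAt_const k)]
      simp
    have hd3 : DifferentiableAt ℝ (fun x => fderiv ℝ (onVec (spectralFun f)) x k) (vecE B) :=
      hd2.clm_apply (differentiableAt_const k)
    rw [h₁, (hgrad k).fderiv_eq]
    have hd4 := (hgrad k).differentiableAt_iff.1 hd3
    refine (hd4.hasFDerivAt.hasLineDerivAt h).unique (HasDerivAt.fun_sum fun j _ => ?_)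
    have e₁ := (hdiff (hu j)).hasFDerivAt.hasLineDerivAt h
    have e₂ := (hdiff (hv j)).hasFDerivAt.hasLineDerivAt h
    have e₃ := (hdiff (hs j)).hasFDerivAt.hasLineDerivAt h
    have e₄ : HasDerivAt (deriv f) (deriv (deriv f) (s j (vecE B + (0 : ℝ) • h)))
        (s j (vecE B + (0 : ℝ) • h)) :=
      (hf.differentiable_deriv_two _).hasDerivAt
    have e₅ := (e₄.comp (0 : ℝ) e₃).mul
      (hasDerivAt_dotProduct e₁ (hasDerivAt_unvecE_mulVec (hasDerivAt_const (0 : ℝ) k) e₂))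
    have hz0 : unvecE (p₁ := p₁) (p₂ := p₂) 0 = 0 := rfl
    convert! e₅ using 1
    simp only [Function.comp_apply, zero_smul, add_zero, hs₀, hu₀, hv₀, hz0, Matrix.zero_mulVec,
      zero_add]
    rw [transpose_mul_mul_apply, transpose_mul_mul_col, transpose_mul_mul_row, hl, hr]

/-! ### The orthogonal matrix and the blocks -/

theorem position_injective : Function.Injective (position (p₁ := p₁) (p₂ := p₂)) := by
  rintro (s | ⟨⟨s, t⟩, hst⟩ | ⟨s, t⟩) (s' | ⟨⟨s', t'⟩, hst'⟩ | ⟨s', t'⟩) h <;>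
  · try have hst₁ : s ≠ t := hst
    try have hst₁' : s' ≠ t' := hst'
    simp only [position] at h
    (try split_ifs at h) <;> simp [Fin.ext_iff] at * <;> omega

theorem position_surjective : Function.Surjective (position (p₁ := p₁) (p₂ := p₂)) := by
  rintro ⟨i, j⟩
  rcases lt_or_ge (i : ℕ) (min p₁ p₂) with hi | hi
  · rcases lt_or_ge (j : ℕ) (min p₁ p₂) with hj | hj
    · by_cases hij : (i : ℕ) = j
      · exact ⟨.inl ⟨i, hi⟩, Prod.ext rfl (Fin.ext hij)⟩
      · exact ⟨.inr (.inl ⟨(⟨i, hi⟩, ⟨j, hj⟩), fun h => hij (congrArg Fin.val h)⟩), rfl⟩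
    · have h : ¬ p₂ ≤ p₁ := by omega
      refine ⟨.inr (.inr (⟨j - min p₁ p₂, by omega⟩, ⟨i, hi⟩)), ?_⟩
      simp only [position, h, dif_neg, not_false_eq_true]
      exact Prod.ext rfl (Fin.ext (by simp; omega))
  · have h : p₂ ≤ p₁ := by omega
    refine ⟨.inr (.inr (⟨i - min p₁ p₂, by omega⟩, ⟨j, by omega⟩)), ?_⟩
    simp only [position, h, dif_pos]
    exact Prod.ext (Fin.ext (by simp; omega)) rfl

/-- Block indices correspond to the entries of a `p₁ × p₂` matrix; the pair is swapped to agree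
with the index order of `Matrix.vec`. -/
noncomputable def positionEquiv (p₁ p₂ : ℕ) : BlockIndex p₁ p₂ ≃ Fin p₂ × Fin p₁ :=
  (Equiv.ofBijective position ⟨position_injective, position_surjective⟩).trans (Equiv.prodComm _ _)

theorem basisMatrix_eq_kronecker (U : Matrix (Fin p₁) (Fin p₁) ℝ) (V : Matrix (Fin p₂) (Fin p₂) ℝ) :
    basisMatrix U V = (Matrix.kroneckerMap (· * ·) V U).submatrix id (positionEquiv p₁ p₂) := by
  ext a k
  exact mul_comm _ _

theorem basisMatrix_transpose_mul_self {U : Matrix (Fin p₁) (Fin p₁) ℝ}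
    {V : Matrix (Fin p₂) (Fin p₂) ℝ} (hU : Uᵀ * U = 1) (hV : Vᵀ * V = 1) :
    (basisMatrix U V)ᵀ * basisMatrix U V = 1 := by
  rw [basisMatrix_eq_kronecker, Matrix.transpose_submatrix, ← Matrix.kroneckerMap_transpose,
    ← Matrix.submatrix_mul _ _ _ _ _ Function.bijective_id, ← Matrix.mul_kronecker_mul, hU, hV,
    Matrix.one_kronecker_one, Matrix.submatrix_one_equiv]

theorem basisMatrix_mul_transpose_self {U : Matrix (Fin p₁) (Fin p₁) ℝ}
    {V : Matrix (Fin p₂) (Fin p₂) ℝ} (hU : U * Uᵀ = 1) (hV : V * Vᵀ = 1) :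
    basisMatrix U V * (basisMatrix U V)ᵀ = 1 := by
  rw [basisMatrix_eq_kronecker, Matrix.transpose_submatrix, ← Matrix.kroneckerMap_transpose,
    ← Matrix.submatrix_mul _ _ _ _ _ (positionEquiv p₁ p₂).bijective, ← Matrix.mul_kronecker_mul,
    hU, hV, Matrix.one_kronecker_one, Matrix.submatrix_id_id]

/-- The row of `Q` at `a` consists of the coordinates of the matrix unit `E_a`. -/
theorem basisMatrix_apply (U : Matrix (Fin p₁) (Fin p₁) ℝ) (V : Matrix (Fin p₂) (Fin p₂) ℝ)
    (a : Fin p₂ × Fin p₁) (k : BlockIndex p₁ p₂) :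
    basisMatrix U V a k =
      (Uᵀ * unvecE (EuclideanSpace.single a 1) * V) (position k).1 (position k).2 := by
  have h : unvecE (EuclideanSpace.single a (1 : ℝ)) = Matrix.single a.2 a.1 1 := by
    ext i j
    simp [unvecE, Matrix.single_apply, Prod.ext_iff, eq_comm, and_comm]
  rw [h, transpose_mul_mul_apply, Matrix.single_mulVec, one_mul]
  exact (dotProduct_single _ _ _).symm

theorem sum_offDiag {n : ℕ} (g : Fin n → Fin n → ℝ) :
    ∑ x : OffDiag n, g x.1.1 x.1.2 = ∑ s, ∑ t, if s = t then 0 else g s t := by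
  rw [← Fintype.sum_prod_type' (f := fun s t => if s = t then 0 else g s t),
    ← Finset.sum_filter_add_sum_filter_not Finset.univ (fun x : Fin n × Fin n => x.1 ≠ x.2),
    Finset.sum_subtype (p := fun x : Fin n × Fin n => x.1 ≠ x.2) _ (by simp)]
  rw [Finset.sum_eq_zero (s := Finset.univ.filter _), add_zero]
  · exact Finset.sum_congr rfl fun x _ => (if_neg x.2).symm
  · intro x hx
    exact if_pos (by simpa using hx)

/-- The column of `A₂` at `y = (k, j)` has its nonzero entries at `(k, j)` and `(j, k)`. -/
theorem sum_mul_blockTwo {n : ℕ} (f : ℝ → ℝ) (σ : Fin n → ℝ) (m : Fin n → Fin n → ℝ)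
    (y : OffDiag n) : ∑ x : OffDiag n, m x.1.1 x.1.2 * blockTwo f σ x y =
      m y.1.1 y.1.2 * ((σ y.1.1 * deriv f (σ y.1.1) - σ y.1.2 * deriv f (σ y.1.2)) /
        (σ y.1.1 ^ 2 - σ y.1.2 ^ 2)) +
      m y.1.2 y.1.1 * -((σ y.1.2 * deriv f (σ y.1.1) - σ y.1.1 * deriv f (σ y.1.2)) /
        (σ y.1.2 ^ 2 - σ y.1.1 ^ 2)) := by
  obtain ⟨⟨k, j⟩, hkj⟩ := y
  rw [Fintype.sum_eq_add ⟨(k, j), hkj⟩ ⟨(j, k), hkj.symm⟩]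
  · have : k ≠ j := hkj
    simp [blockTwo, this]
  · simp only [ne_eq, Subtype.mk.injEq, Prod.mk.injEq, not_and]
    exact fun h => absurd h hkj
  · rintro ⟨⟨s, t⟩, hst⟩ ⟨h₁, h₂⟩
    simp only [ne_eq, Subtype.mk.injEq, Prod.mk.injEq] at h₁ h₂
    have h₃ : ¬ ((k, j) = (s, t)) := by simp only [Prod.mk.injEq]; grind
    have h₄ : ¬ ((k, j) = (t, s)) := by simp only [Prod.mk.injEq]; grind
    simp [blockTwo, h₃, h₄]

theorem sum_univ_eq_sum_add_sum {n p d : ℕ} (h : n = p + d) (g : Fin n → ℝ) :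
    ∑ i, g i = ∑ k : Fin p, g ⟨k, by omega⟩ + ∑ r : Fin d, g ⟨p + r, by omega⟩ := by
  subst h
  exact Fin.sum_univ_add g

/-- The bilinear form of `blockMatrix`, written out. -/
theorem sum_blockMatrix (f : ℝ → ℝ) (σ : Fin (min p₁ p₂) → ℝ) (m N : Matrix (Fin p₁) (Fin p₂) ℝ) :
    ∑ y, (∑ x, m (position x).1 (position x).2 * blockMatrix f σ x y) *
        N (position y).1 (position y).2 =
      ∑ s, m (diagRow s) (diagCol s) * deriv (deriv f) (σ s) * N (diagRow s) (diagCol s) +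
      (∑ k, ∑ j, (if k = j then 0 else
        (m (diagRow k) (diagCol j) * ((σ k * deriv f (σ k) - σ j * deriv f (σ j)) /
          (σ k ^ 2 - σ j ^ 2)) +
        m (diagRow j) (diagCol k) * -((σ j * deriv f (σ k) - σ k * deriv f (σ j)) /
          (σ j ^ 2 - σ k ^ 2))) * N (diagRow k) (diagCol j)) +
      ∑ t, ∑ r, deriv f (σ t) * (m (position (.inr (.inr (r, t)))).1
        (position (.inr (.inr (r, t)))).2 / σ t * N (position (.inr (.inr (r, t)))).1
        (position (.inr (.inr (r, t)))).2)) := by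
  rw [Fintype.sum_sum_type, Fintype.sum_sum_type]
  refine congrArg₂ _ (Finset.sum_congr rfl fun s _ => ?_) (congrArg₂ _ ?_ ?_)
  · simp only [Fintype.sum_sum_type, blockMatrix, Matrix.fromBlocks_apply₁₁,
      Matrix.fromBlocks_apply₂₁, Matrix.zero_apply, mul_zero, Finset.sum_const_zero, add_zero,
      blockOne, Matrix.diagonal_apply, mul_ite, Finset.sum_ite_eq', Finset.mem_univ, if_true]
    rfl
  · rw [← sum_offDiag fun k j => (m (diagRow k) (diagCol j) *
      ((σ k * deriv f (σ k) - σ j * deriv f (σ j)) / (σ k ^ 2 - σ j ^ 2)) +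
        m (diagRow j) (diagCol k) * -((σ j * deriv f (σ k) - σ k * deriv f (σ j)) /
          (σ j ^ 2 - σ k ^ 2))) * N (diagRow k) (diagCol j)]
    refine Finset.sum_congr rfl fun y _ => ?_
    rw [← sum_mul_blockTwo f σ (fun k j => m (diagRow k) (diagCol j))]
    simp only [Fintype.sum_sum_type, blockMatrix, Matrix.fromBlocks_apply₁₁,
      Matrix.fromBlocks_apply₂₁, Matrix.fromBlocks_apply₁₂, Matrix.fromBlocks_apply₂₂,
      Matrix.zero_apply, mul_zero, Finset.sum_const_zero, add_zero, zero_add]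
    rfl
  · rw [Fintype.sum_prod_type, Finset.sum_comm]
    refine Finset.sum_congr rfl fun t _ => Finset.sum_congr rfl fun r _ => ?_
    simp only [Fintype.sum_sum_type, blockMatrix,
      Matrix.fromBlocks_apply₁₂, Matrix.fromBlocks_apply₂₂,
      Matrix.zero_apply, mul_zero, Finset.sum_const_zero, zero_add, blockThree,
      Matrix.diagonal_apply, mul_ite, Finset.sum_ite_eq', Finset.mem_univ, if_true]
    ring

/-- In the coordinates of a singular value decomposition, the part of the perturbed triple outside
the diagonal square is the contribution of the third block. -/
theorem LinearizedTriple.sum_add_sum {σ : Fin (min p₁ p₂) → ℝ} {j : Fin (min p₁ p₂)}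
    {m : Matrix (Fin p₁) (Fin p₂) ℝ} {a : Fin p₁ → ℝ} {b : Fin p₂ → ℝ} {c : ℝ}
    (h : LinearizedTriple σ j m a b c) (hσ : σ j ≠ 0) (N : Matrix (Fin p₁) (Fin p₂) ℝ) :
    a ⬝ᵥ N.col (diagCol j) + N.row (diagRow j) ⬝ᵥ b =
      ∑ k : Fin (min p₁ p₂), a (diagRow k) * N (diagRow k) (diagCol j) +
      ∑ k : Fin (min p₁ p₂), b (diagCol k) * N (diagRow j) (diagCol k) +
      ∑ r, m (position (.inr (.inr (r, j)))).1 (position (.inr (.inr (r, j)))).2 / σ j *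
        N (position (.inr (.inr (r, j)))).1 (position (.inr (.inr (r, j)))).2 := by
  rw [dotProduct, dotProduct]
  by_cases hp : p₂ ≤ p₁
  · rw [sum_univ_eq_sum_add_sum (show p₁ = min p₁ p₂ + (max p₁ p₂ - min p₁ p₂) by omega),
      sum_univ_eq_sum_add_sum (show p₂ = min p₁ p₂ + 0 by omega)]
    have hr : ∀ r : Fin (max p₁ p₂ - min p₁ p₂), a ⟨min p₁ p₂ + r, by omega⟩ =
        m ⟨min p₁ p₂ + r, by omega⟩ (diagCol j) / σ j := fun r =>
      h.left_of_le hσ (Nat.le_add_right _ _)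
    simp only [position, hp, dif_pos, hr, Finset.univ_eq_empty, Finset.sum_empty, add_zero,
      mul_comm (N.row _ _)]
    exact add_right_comm _ _ _
  · rw [sum_univ_eq_sum_add_sum (show p₂ = min p₁ p₂ + (max p₁ p₂ - min p₁ p₂) by omega),
      sum_univ_eq_sum_add_sum (show p₁ = min p₁ p₂ + 0 by omega)]
    have hr : ∀ r : Fin (max p₁ p₂ - min p₁ p₂), b ⟨min p₁ p₂ + r, by omega⟩ =
        m (diagRow j) ⟨min p₁ p₂ + r, by omega⟩ / σ j := fun r =>
      h.right_of_le hσ (Nat.le_add_right _ _)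
    simp only [position, hp, dif_neg, not_false_eq_true, hr, Finset.univ_eq_empty,
      Finset.sum_empty, add_zero, mul_comm (N.row _ _)]
    exact (add_assoc _ _ _).symm

/-- With the perturbed triples solved for, the second derivative is the bilinear form of
`blockMatrix`. The entry `N_kj` with `k ≠ j` is multiplied both by the `k`-th coordinate of the left
vector of the `j`-th triple and by the `j`-th coordinate of the right vector of the `k`-th triple;
the two contributions add up to the entries of `A₂`. -/
theorem sum_linearizedTriple_eq_sum_blockMatrix (f : ℝ → ℝ) {σ : Fin (min p₁ p₂) → ℝ}
    {m : Matrix (Fin p₁) (Fin p₂) ℝ} {a : Fin (min p₁ p₂) → Fin p₁ → ℝ}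
    {b : Fin (min p₁ p₂) → Fin p₂ → ℝ} {c : Fin (min p₁ p₂) → ℝ}
    (h : ∀ j, LinearizedTriple σ j m (a j) (b j) (c j)) (hσ : ∀ j, σ j ≠ 0)
    (hd : ∀ k j, k ≠ j → σ k ^ 2 - σ j ^ 2 ≠ 0) (N : Matrix (Fin p₁) (Fin p₂) ℝ) :
    ∑ j, (deriv (deriv f) (σ j) * c j * N (diagRow j) (diagCol j) +
      deriv f (σ j) * (a j ⬝ᵥ N.col (diagCol j) + N.row (diagRow j) ⬝ᵥ b j)) =
    ∑ y, (∑ x, m (position x).1 (position x).2 * blockMatrix f σ x y) *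
        N (position y).1 (position y).2 := by
  rw [sum_blockMatrix, Finset.sum_add_distrib]
  refine congrArg₂ _ (Finset.sum_congr rfl fun j _ => by rw [(h j).value_eq]; ring) ?_
  simp only [(h _).sum_add_sum (hσ _), mul_add, Finset.sum_add_distrib, Finset.mul_sum]
  refine congrArg₂ _ ?_ rfl
  -- both sums over pairs are indexed by the entry of `N` that they multiply
  rw [Finset.sum_comm, ← Finset.sum_add_distrib]
  refine Finset.sum_congr rfl fun k _ => ?_
  rw [← Finset.sum_add_distrib]
  refine Finset.sum_congr rfl fun j _ => ?_
  by_cases hkj : k = j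
  · subst hkj
    simp [(h k).left_self (hσ k), (h k).right_self (hσ k)]
  · rw [if_neg hkj, (h j).left_off hkj (hd k j hkj), (h k).right_off (Ne.symm hkj)
      (hd j k (Ne.symm hkj))]
    have h₁ := hd k j hkj
    have h₂ : σ j ^ 2 - σ k ^ 2 = -(σ k ^ 2 - σ j ^ 2) := by ring
    rw [h₂]
    field_simp
    ring

end SpectralHessian

theorem theorem7 (p₁ p₂ : ℕ) (f : ℝ → ℝ) (hf : ContDiff ℝ 2 f)
    (B : Matrix (Fin p₁) (Fin p₂) ℝ) (U : Matrix (Fin p₁) (Fin p₁) ℝ)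
    (σ : Fin (min p₁ p₂) → ℝ) (V : Matrix (Fin p₂) (Fin p₂) ℝ)
    (hB : SpectralHessian.IsSVD B U σ V)
    (hσ_distinct : ∀ s t, s ≠ t → σ s ≠ σ t) (hσ_ne_zero : ∀ s, σ s ≠ 0) :
    ContDiffAt ℝ 2 (SpectralHessian.onVec (SpectralHessian.spectralFun f))
        (SpectralHessian.vecE B) ∧
      (SpectralHessian.basisMatrix U V)ᵀ * SpectralHessian.basisMatrix U V = 1 ∧
      SpectralHessian.basisMatrix U V * (SpectralHessian.basisMatrix U V)ᵀ = 1 ∧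
      SpectralHessian.hessianMatrix (SpectralHessian.onVec (SpectralHessian.spectralFun f))
          (SpectralHessian.vecE B) =
        SpectralHessian.basisMatrix U V * SpectralHessian.blockMatrix f σ *
          (SpectralHessian.basisMatrix U V)ᵀ := by
  have hpos : ∀ j, 0 < σ j := fun j => (hB.nonneg j).lt_of_ne' (hσ_ne_zero j)
  -- the `σ j` are nonnegative, so distinctness passes to their squares
  have hd : ∀ k j, k ≠ j → σ k ^ 2 - σ j ^ 2 ≠ 0 := fun k j hkj h =>
    hσ_distinct k j hkj ((sq_eq_sq₀ (hB.nonneg k) (hB.nonneg j)).1 (sub_eq_zero.1 h))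
  obtain ⟨hC, hH⟩ := hB.fderiv_fderiv_spectralFun hf hpos
    (fun k j hkj => by_contra fun hne => hσ_distinct k j hne hkj) hd
  refine ⟨hC, SpectralHessian.basisMatrix_transpose_mul_self
    ((Matrix.mem_orthogonalGroup_iff' _ _).1 hB.left_orthogonal)
    ((Matrix.mem_orthogonalGroup_iff' _ _).1 hB.right_orthogonal),
    SpectralHessian.basisMatrix_mul_transpose_self
    ((Matrix.mem_orthogonalGroup_iff _ _).1 hB.left_orthogonal)
    ((Matrix.mem_orthogonalGroup_iff _ _).1 hB.right_orthogonal), ?_⟩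
  ext i j
  obtain ⟨a, b, c, habc, hder⟩ := hH (EuclideanSpace.single i 1)
  rw [SpectralHessian.hessianMatrix, Matrix.of_apply, hder,
    SpectralHessian.sum_linearizedTriple_eq_sum_blockMatrix f habc hσ_ne_zero hd]
  simp only [Matrix.mul_apply, Matrix.transpose_apply, SpectralHessian.basisMatrix_apply]
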